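/- Let $G$ be a finitely generated group, let $X$ be a finite generating set of $G$, and let $H\le G$ be an infinite subgroup of infinite index. Suppose that $H$ is strongly quasi-convex in $G$: for all real $\lambda\ge 1$, $C\ge 0$ there is a constant $N=N(\lambda,C)$ such that every $(\lambda,C)$-quasi-geodesic in the Cayley graph $\Gamma(G,X)$ (with edges of length $1$) connecting two points of $H$ is contained in the $N$-neighbourhood of $H$. Here a $(\lambda,C)$-quasi-geodesic in a metric space $(S,d)$ is a path $p\colon[0,\ell]\to S$ with $\frac{|s-t|}{\lambda}-C\le d(p(s),p(t))\le\lambda|s-t|+C$ for all $s,t\in[0,\ell]$. Then every asymptotic cone of $G$ contains a cut point. That is: let $Y$ be any finite generating set of $G$ with word metric $d_Y$, let $\omega$ be any non-principal ultrafilter on $\mathbb{N}$, and let $(c_i)$ be any unbounded, strictly increasing sequence of positive real numbers. Let $\mathrm{Cone}^{\omega}(G)$ be the metric space obtained from the set of sequences $(g_i)$ in $G$ with $d_Y(e,g_i)/c_i$ bounded, with the pseudo-metric $d^*((g_i),(h_i))=\lim^{\omega}d_Y(g_i,h_i)/c_i$, by identifying sequences at pseudo-distance $0$. Then $\mathrm{Cone}^{\omega}(G)$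 is connected and there is a point $p\in\mathrm{Cone}^{\omega}(G)$ such that $\mathrm{Cone}^{\omega}(G)\setminus\{p\}$ is not connected. -/

import Mathlib

open Filter Topology

noncomputable section

/-! ### The geometric realization of a connected graph, with edges of length one -/

/-- The points of the geometric realization of a graph `Γ`, in barycentric coordinates: the convex
combinations `(1 - t) u + t v` where `u`, `v` are equal or adjacent vertices and `t ∈ [0, 1]`. The
connectedness proof is recorded in the type because the metric below refers to it. -/
@[ext] structure GraphRealization {V : Type*} (Γ : SimpleGraph V) (hΓ : Γ.Connected) where
  coord : V →₀ ℝ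
  mem_edge : ∃ u v : V, (u = v ∨ Γ.Adj u v) ∧ ∃ t ∈ Set.Icc (0 : ℝ) 1,
    coord = Finsupp.single u (1 - t) + Finsupp.single v t

namespace GraphRealization

variable {V : Type*} {Γ : SimpleGraph V} {hΓ : Γ.Connected}

/-- A vertex, as a point of the realization. -/
def vertex (hΓ : Γ.Connected) (v : V) : GraphRealization Γ hΓ where
  coord := Finsupp.single v 1
  mem_edge := ⟨v, v, Or.inl rfl, 0, by simp, by simp⟩

/-- `x` and `y` lie on a common closed edge (or are the same vertex). -/
def OnCommonEdge (x y : GraphRealization Γ hΓ) : Prop :=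
  ∃ u v : V, (u = v ∨ Γ.Adj u v) ∧ ∀ a, x.coord a ≠ 0 ∨ y.coord a ≠ 0 → a = u ∨ a = v

lemma coord_nonneg (x : GraphRealization Γ hΓ) (a : V) : 0 ≤ x.coord a := by
  classical
  obtain ⟨u, v, -, t, ⟨h0, h1⟩, hx⟩ := x.mem_edge
  rw [hx, Finsupp.add_apply, Finsupp.single_apply, Finsupp.single_apply]
  split_ifs <;> linarith

lemma coord_add_le (x : GraphRealization Γ hΓ) {a b : V} (hab : a ≠ b) :
    x.coord a + x.coord b ≤ 1 := by
  classical
  obtain ⟨u, v, -, t, ⟨h0, h1⟩, hx⟩ := x.mem_edge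
  simp only [hx, Finsupp.add_apply, Finsupp.single_apply]
  split_ifs <;> first | linarith | (exfalso; simp_all)

lemma coord_le_one (x : GraphRealization Γ hΓ) (a : V) : x.coord a ≤ 1 := by
  classical
  obtain ⟨u, v, -, t, ⟨h0, h1⟩, hx⟩ := x.mem_edge
  rw [hx, Finsupp.add_apply, Finsupp.single_apply, Finsupp.single_apply]
  split_ifs <;> linarith

/-- Either `x` is a vertex, or it is interior to an edge. -/
lemma cases_point (x : GraphRealization Γ hΓ) :
    (∃ w, x = vertex hΓ w) ∨
    ∃ u v, Γ.Adj u v ∧ 0 < x.coord u ∧ 0 < x.coord v ∧ x.coord u + x.coord v = 1 ∧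
      ∀ a, x.coord a ≠ 0 → a = u ∨ a = v := by
  classical
  obtain ⟨u, v, huv, t, ⟨h0, h1⟩, hx⟩ := x.mem_edge
  by_cases huv' : u = v
  · refine Or.inl ⟨u, GraphRealization.ext ?_⟩
    rw [hx, ← huv', ← Finsupp.single_add]; simp [vertex]
  by_cases ht0 : t = 0
  · refine Or.inl ⟨u, GraphRealization.ext ?_⟩
    rw [hx, ht0]; simp [vertex]
  by_cases ht1 : t = 1
  · refine Or.inl ⟨v, GraphRealization.ext ?_⟩
    rw [hx, ht1]; simp [vertex]
  right
  have e1 : x.coord u = 1 - t := by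
    rw [hx, Finsupp.add_apply, Finsupp.single_eq_same, Finsupp.single_apply, if_neg (Ne.symm huv')]
    simp
  have e2 : x.coord v = t := by
    rw [hx, Finsupp.add_apply, Finsupp.single_eq_same, Finsupp.single_apply, if_neg huv']
    simp
  refine ⟨u, v, huv.resolve_left huv', ?_, ?_, ?_, ?_⟩
  · rw [e1]; exact sub_pos.mpr (lt_of_le_of_ne h1 ht1)
  · rw [e2]; exact lt_of_le_of_ne h0 (Ne.symm ht0)
  · rw [e1, e2]; ring
  · intro a ha
    rw [hx, Finsupp.add_apply, Finsupp.single_apply, Finsupp.single_apply] at ha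
    by_contra! hc
    rw [if_neg (Ne.symm hc.1), if_neg (Ne.symm hc.2)] at ha
    simp at ha

lemma support_nonempty (x : GraphRealization Γ hΓ) : x.coord.support.Nonempty := by
  rcases x.cases_point with ⟨w, rfl⟩ | ⟨u, v, -, hu, -⟩
  · exact ⟨w, by simp [vertex]⟩
  · exact ⟨u, by simpa using hu.ne'⟩

/-- The distance from the point `x` to the vertex `a`: the length of a shortest route that goes
along the edge of `x` to an end `u` of that edge, and then from `u` to `a` in the graph. -/
def distToVertex (x : GraphRealization Γ hΓ) (a : V) : ℝ :=
  x.coord.support.inf' x.support_nonempty (fun u => (1 - x.coord u) + (Γ.dist u a : ℝ))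

open Classical in
/-- The path distance of the realization: the points with parameters `s`, `t` on a common edge are
at distance `|s - t|` (the largest difference of their barycentric coordinates); otherwise a
shortest path from `x` to `y` passes through some vertex. -/
def pathDist (x y : GraphRealization Γ hΓ) : ℝ :=
  if OnCommonEdge x y then ⨆ a : V, |x.coord a - y.coord a|
  else ⨅ a : V, (x.distToVertex a + y.distToVertex a)

lemma abs_coord_sub_le_one (x y : GraphRealization Γ hΓ) (a : V) :
    |x.coord a - y.coord a| ≤ 1 := by
  have := x.coord_nonneg a; have := x.coord_le_one a
  have := y.coord_nonneg a; have := y.coord_le_one a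
  rw [abs_le]; constructor <;> linarith

lemma bddAbove_coord (x y : GraphRealization Γ hΓ) :
    BddAbove (Set.range fun a => |x.coord a - y.coord a|) :=
  ⟨1, by rintro _ ⟨a, rfl⟩; exact abs_coord_sub_le_one x y a⟩

lemma distToVertex_le (x : GraphRealization Γ hΓ) {u : V} (hu : x.coord u ≠ 0) (a : V) :
    x.distToVertex a ≤ (1 - x.coord u) + Γ.dist u a :=
  Finset.inf'_le _ (by simpa using hu)

lemma exists_distToVertex (x : GraphRealization Γ hΓ) (a : V) :
    ∃ u, x.coord u ≠ 0 ∧ x.distToVertex a = (1 - x.coord u) + Γ.dist u a := by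
  obtain ⟨u, hu, h⟩ := Finset.exists_mem_eq_inf' x.support_nonempty
    (fun u => (1 - x.coord u) + (Γ.dist u a : ℝ))
  exact ⟨u, by simpa using hu, h⟩

lemma distToVertex_nonneg (x : GraphRealization Γ hΓ) (a : V) : 0 ≤ x.distToVertex a := by
  obtain ⟨u, -, h⟩ := x.exists_distToVertex a
  rw [h]
  have := x.coord_le_one u
  have : (0 : ℝ) ≤ Γ.dist u a := Nat.cast_nonneg _
  linarith

lemma bddBelow_route (x y : GraphRealization Γ hΓ) :
    BddBelow (Set.range fun a => x.distToVertex a + y.distToVertex a) :=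
  ⟨0, by rintro _ ⟨a, rfl⟩; exact add_nonneg (x.distToVertex_nonneg a) (y.distToVertex_nonneg a)⟩

lemma OnCommonEdge.symm {x y : GraphRealization Γ hΓ} (h : OnCommonEdge x y) :
    OnCommonEdge y x := by
  obtain ⟨u, v, h1, h2⟩ := h
  exact ⟨u, v, h1, fun a ha => h2 a ha.symm⟩

lemma onCommonEdge_self (x : GraphRealization Γ hΓ) : OnCommonEdge x x := by
  rcases x.cases_point with ⟨w, rfl⟩ | ⟨u, v, h, -, -, -, h'⟩
  · refine ⟨w, w, Or.inl rfl, fun a ha => ?_⟩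
    by_contra hc
    push Not at hc
    simp [vertex, Finsupp.single_eq_of_ne hc.1] at ha
  · exact ⟨u, v, Or.inr h, fun a ha => h' a (by simpa using ha)⟩

lemma pathDist_comm (x y : GraphRealization Γ hΓ) : pathDist x y = pathDist y x := by
  unfold pathDist
  by_cases h : OnCommonEdge x y
  · rw [if_pos h, if_pos h.symm]
    simp_rw [abs_sub_comm]
  · rw [if_neg h, if_neg fun h' => h h'.symm]
    simp_rw [add_comm]

lemma pathDist_self (x : GraphRealization Γ hΓ) : pathDist x x = 0 := by
  have := hΓ.nonempty
  simp [pathDist, if_pos x.onCommonEdge_self]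

lemma cast_dist_triangle (hΓ : Γ.Connected) (a b c : V) :
    (Γ.dist a c : ℝ) ≤ Γ.dist a b + Γ.dist b c := by
  exact_mod_cast hΓ.dist_triangle

/-- Change of point along an edge. -/
lemma distToVertex_le_of_common {x y : GraphRealization Γ hΓ} (h : OnCommonEdge x y) (a : V) :
    y.distToVertex a ≤ pathDist x y + x.distToVertex a := by
  obtain ⟨u, hu, hxa⟩ := x.exists_distToVertex a
  have hL : |x.coord u - y.coord u| ≤ pathDist x y := by
    rw [pathDist, if_pos h]; exact le_ciSup (bddAbove_coord x y) u
  have hL' := (le_abs_self _).trans hL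
  rw [hxa]
  by_cases hy : y.coord u = 0
  · obtain ⟨w, hw⟩ := y.support_nonempty
    have hw : y.coord w ≠ 0 := by simpa using hw
    have key : y.coord w = 1 ∧ Γ.dist u w ≤ 1 := by
      obtain ⟨p, q, hpq, hs⟩ := h
      have hwu : w ≠ u := fun e => hw (e ▸ hy)
      have h1 := hs u (Or.inl hu)
      have h2 := hs w (Or.inr hw)
      have hadj : Γ.Adj u w := by
        rcases hpq with rfl | hpq
        · exfalso; rcases h1 with rfl | rfl <;> simp_all
        · rcases h1 with rfl | rfl <;> rcases h2 with rfl | rfl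
          · exact absurd rfl hwu
          · exact hpq
          · exact hpq.symm
          · exact absurd rfl hwu
      refine ⟨?_, (SimpleGraph.dist_eq_one_iff_adj.mpr hadj).le⟩
      rcases y.cases_point with ⟨z, rfl⟩ | ⟨b, c, hbc, hb, hc, hbc1, hsupp⟩
      · by_cases hz : w = z
        · subst hz; simp [vertex]
        · simp [vertex, Finsupp.single_eq_of_ne hz] at hw
      · exfalso
        have hb' := hs b (Or.inr hb.ne')
        have hc' := hs c (Or.inr hc.ne')
        have hbu : b ≠ u := by rintro rfl; linarith
        have hcu : c ≠ u := by rintro rfl; linarith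
        have := hbc.ne
        rcases h1 with rfl | rfl <;> simp_all
    have h1 := y.distToVertex_le hw a
    have h2 := cast_dist_triangle hΓ w u a
    have h3 : (Γ.dist w u : ℝ) ≤ 1 := by rw [SimpleGraph.dist_comm]; exact_mod_cast key.2
    rw [key.1] at h1
    rw [hy] at hL'
    linarith
  · have := y.distToVertex_le hy a
    linarith

lemma dist_le_distToVertex_add (y : GraphRealization Γ hΓ) (a b : V) :
    (Γ.dist a b : ℝ) ≤ y.distToVertex a + y.distToVertex b := by
  obtain ⟨u, hu, h1⟩ := y.exists_distToVertex a
  obtain ⟨v, hv, h2⟩ := y.exists_distToVertex b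
  have huv : (Γ.dist u v : ℝ) ≤ (1 - y.coord u) + (1 - y.coord v) := by
    by_cases e : u = v
    · subst e
      have := y.coord_le_one u
      simp; linarith
    · have h3 := y.coord_add_le e
      have hadj : Γ.Adj u v := by
        obtain ⟨p, q, hpq, hs⟩ := y.onCommonEdge_self
        have h1 := hs u (Or.inl hu)
        have h2 := hs v (Or.inl hv)
        rcases hpq with rfl | hpq
        · exfalso; simp_all
        · rcases h1 with rfl | rfl <;> rcases h2 with rfl | rfl <;>
            first | exact absurd rfl e | exact hpq | exact hpq.symm
      rw [SimpleGraph.dist_eq_one_iff_adj.mpr hadj]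
      push_cast; linarith
  have t1 := cast_dist_triangle hΓ a u b
  have t2 := cast_dist_triangle hΓ u v b
  rw [SimpleGraph.dist_comm (u := a) (v := u)] at t1
  linarith

lemma distToVertex_le_add (x : GraphRealization Γ hΓ) (a b : V) :
    x.distToVertex b ≤ x.distToVertex a + Γ.dist a b := by
  obtain ⟨u, hu, h1⟩ := x.exists_distToVertex a
  have := x.distToVertex_le hu b
  have := cast_dist_triangle hΓ u a b
  linarith

lemma pathDist_le_route (x y : GraphRealization Γ hΓ) (a : V) :
    pathDist x y ≤ x.distToVertex a + y.distToVertex a := by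
  have := hΓ.nonempty
  by_cases h : OnCommonEdge x y
  · rw [pathDist, if_pos h]
    refine ciSup_le fun w => ?_
    obtain ⟨u, hu, h1⟩ := x.exists_distToVertex a
    obtain ⟨v, hv, h2⟩ := y.exists_distToVertex a
    have t := cast_dist_triangle hΓ u a v
    rw [SimpleGraph.dist_comm (u := a)] at t
    have xu := x.coord_le_one u
    have yv := y.coord_le_one v
    by_cases e : u = v
    · subst e
      have yu := y.coord_le_one u
      have p1 : (0 : ℝ) ≤ Γ.dist u a := Nat.cast_nonneg _
      have n1 := x.coord_nonneg w
      have n2 := y.coord_nonneg w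
      rw [h1, h2, abs_le]
      by_cases e : w = u
      · subst e; constructor <;> linarith
      · have := x.coord_add_le e
        have := y.coord_add_le e
        constructor <;> linarith
    · have p : (1 : ℝ) ≤ Γ.dist u v := by exact_mod_cast hΓ.pos_dist_of_ne e
      have := abs_coord_sub_le_one x y w
      linarith
  · rw [pathDist, if_neg h]
    exact ciInf_le (bddBelow_route x y) a

lemma distToVertex_le_pathDist_add (x y : GraphRealization Γ hΓ) (a : V) :
    x.distToVertex a ≤ pathDist x y + y.distToVertex a := by
  have := hΓ.nonempty
  by_cases h : OnCommonEdge x y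
  · rw [pathDist_comm]; exact distToVertex_le_of_common h.symm a
  · rw [pathDist, if_neg h, ← sub_le_iff_le_add]
    refine le_ciInf fun b => ?_
    have := x.distToVertex_le_add b a
    have := y.dist_le_distToVertex_add b a
    linarith

lemma distToVertex_vertex_self (w : V) : (vertex hΓ w).distToVertex w = 0 := by
  refine le_antisymm ?_ (distToVertex_nonneg _ _)
  have := (vertex hΓ w).distToVertex_le (u := w) (by simp [vertex]) w
  simpa [vertex] using this

lemma pathDist_triangle (x y z : GraphRealization Γ hΓ) :
    pathDist x z ≤ pathDist x y + pathDist y z := by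
  have := hΓ.nonempty
  by_cases hyz : OnCommonEdge y z
  · by_cases hxy : OnCommonEdge x y
    · rcases y.cases_point with ⟨w, rfl⟩ | ⟨u, v, huv, hu, hv, -, -⟩
      · have h1 := distToVertex_le_pathDist_add x (vertex hΓ w) w
        have h2 := distToVertex_le_pathDist_add z (vertex hΓ w) w
        have h3 := pathDist_le_route x z w
        rw [distToVertex_vertex_self] at h1 h2
        rw [pathDist_comm z] at h2
        linarith
      · have hxz : OnCommonEdge x z := by
          obtain ⟨p, q, hpq, h1⟩ := hxy
          obtain ⟨r, s, hrs, h2⟩ := hyz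
          have hne := huv.ne
          have a1 := h1 u (Or.inr hu.ne')
          have a2 := h1 v (Or.inr hv.ne')
          have a3 := h2 u (Or.inl hu.ne')
          have a4 := h2 v (Or.inl hv.ne')
          refine ⟨u, v, Or.inr huv, fun a ha => ?_⟩
          rcases ha with ha | ha
          · have := h1 a (Or.inl ha); grind
          · have := h2 a (Or.inr ha); grind
        rw [pathDist, pathDist, pathDist, if_pos hxz, if_pos hyz, if_pos hxy]
        refine ciSup_le fun a => ?_
        exact (abs_sub_le _ (y.coord a) _).trans
          (add_le_add (le_ciSup (bddAbove_coord x y) a) (le_ciSup (bddAbove_coord y z) a))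
    · rw [← sub_le_iff_le_add]
      conv_rhs => rw [pathDist, if_neg hxy]
      refine le_ciInf fun a => ?_
      have h1 := pathDist_le_route x z a
      have h2 := distToVertex_le_pathDist_add z y a
      rw [pathDist_comm z y] at h2
      linarith
  · rw [← sub_le_iff_le_add']
    conv_rhs => rw [pathDist, if_neg hyz]
    refine le_ciInf fun a => ?_
    have h1 := pathDist_le_route x z a
    have h2 := distToVertex_le_pathDist_add x y a
    linarith

lemma eq_of_pathDist_eq_zero {x y : GraphRealization Γ hΓ} (h : pathDist x y = 0) : x = y := by
  have key' : ∀ (x : GraphRealization Γ hΓ) (w : V),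
      pathDist x (vertex hΓ w) = 0 → x = vertex hΓ w := by
    intro x w hw
    have h1 := distToVertex_le_pathDist_add x (vertex hΓ w) w
    rw [hw, distToVertex_vertex_self] at h1
    obtain ⟨u, hu, h2⟩ := x.exists_distToVertex w
    have p1 : (0 : ℝ) ≤ Γ.dist u w := Nat.cast_nonneg _
    have p2 := x.coord_le_one u
    have p3 : (Γ.dist u w : ℝ) = 0 := by linarith
    have p4 : x.coord u = 1 := by linarith
    have p5 : u = w := hΓ.dist_eq_zero_iff.mp (by exact_mod_cast p3)
    subst p5
    refine GraphRealization.ext (Finsupp.ext fun a => ?_)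
    by_cases e : a = u
    · subst e; simp [vertex, p4]
    · have := x.coord_add_le e
      have := x.coord_nonneg a
      rw [vertex, Finsupp.single_eq_of_ne e]; linarith
  by_cases hc : OnCommonEdge x y
  · rw [pathDist, if_pos hc] at h
    refine GraphRealization.ext (Finsupp.ext fun a => ?_)
    have h1 := le_ciSup (bddAbove_coord x y) a
    rw [h] at h1
    exact sub_eq_zero.mp (abs_eq_zero.mp (le_antisymm h1 (abs_nonneg _)))
  · rcases x.cases_point with ⟨w, rfl⟩ | ⟨u, v, -, hu, hv, huv, hs⟩
    · rw [pathDist_comm] at h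
      exact (key' y w h).symm
    · exfalso
      have hlow : min (x.coord u) (x.coord v) ≤ pathDist x y := by
        have := hΓ.nonempty
        rw [pathDist, if_neg hc]
        refine le_ciInf fun a => ?_
        obtain ⟨b, hb, h1⟩ := x.exists_distToVertex a
        have p1 : (0 : ℝ) ≤ Γ.dist b a := Nat.cast_nonneg _
        have p2 := y.distToVertex_nonneg a
        have p3 := min_le_left (x.coord u) (x.coord v)
        have p4 := min_le_right (x.coord u) (x.coord v)
        rcases hs b hb with rfl | rfl <;> linarith
      have := lt_min hu hv
      linarith

instance : MetricSpace (GraphRealization Γ hΓ) where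
  dist := pathDist
  dist_self := pathDist_self
  dist_comm := pathDist_comm
  dist_triangle := pathDist_triangle
  eq_of_dist_eq_zero := eq_of_pathDist_eq_zero

end GraphRealization

/-! ### Cayley graphs, word metrics and strong quasi-convexity -/

lemma mulCayley_connected {G : Type*} [Group G] {X : Set G} (hX : Subgroup.closure X = ⊤) :
    (SimpleGraph.mulCayley X).Connected := by
  have step : ∀ g s : G, s ∈ X → (SimpleGraph.mulCayley X).Reachable g (g * s) := by
    intro g s hs
    by_cases e : g = g * s
    · rw [← e]
    · exact SimpleGraph.Adj.reachable
        ((SimpleGraph.mulCayley_adj X _ _).mpr ⟨e, Or.inl (by simpa using hs)⟩)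
  have h1 : ∀ x : G, ∀ g : G, (SimpleGraph.mulCayley X).Reachable g (g * x) := by
    intro x
    have hx : x ∈ Subgroup.closure X := by rw [hX]; trivial
    induction hx using Subgroup.closure_induction with
    | mem s hs => exact fun g => step g s hs
    | one => intro g; rw [mul_one]
    | mul a b _ _ ha hb => intro g; rw [← mul_assoc]; exact (ha g).trans (hb _)
    | inv a _ ha => intro g; simpa using (ha (g * a⁻¹)).symm
  exact { preconnected := fun u v => by simpa using h1 (u⁻¹ * v) u
          nonempty := ⟨1⟩ }

/-- The Cayley graph `Γ(G, X)` of `G` with respect to a generating set `X`, as a metric space in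
which every edge has length one. -/
abbrev CayleyGraph {G : Type*} [Group G] (X : Set G) (hX : Subgroup.closure X = ⊤) : Type _ :=
  GraphRealization (SimpleGraph.mulCayley X) (mulCayley_connected hX)

/-- The group `G` regarded as a metric space by means of the word metric of the generating set `X`:
the distance of `g` and `h` is the least length of an edge path from `g` to `h` in the Cayley graph,
i.e. of a word in `X ∪ X⁻¹` representing `g⁻¹ * h`. -/
@[ext] structure WordMetricSpace {G : Type*} [Group G] (X : Set G)
    (hX : Subgroup.closure X = ⊤) where
  elt : G

instance {G : Type*} [Group G] (X : Set G) (hX : Subgroup.closure X = ⊤) :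
    MetricSpace (WordMetricSpace X hX) where
  dist g h := ((SimpleGraph.mulCayley X).dist g.elt h.elt : ℝ)
  dist_self g := by simp
  dist_comm g h := by rw [SimpleGraph.dist_comm]
  dist_triangle a b c := by exact_mod_cast (mulCayley_connected hX).dist_triangle
  eq_of_dist_eq_zero {a b} h :=
    WordMetricSpace.ext ((mulCayley_connected hX).dist_eq_zero_iff.mp (by exact_mod_cast h))

/-- A `(lam, C)`-quasi-geodesic path `p : [0, ℓ] → S`: a path that is a `(lam, C)`-quasi-isometric
embedding. (The values of `p` outside `[0, ℓ]` are irrelevant.) -/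
def IsQuasiGeodesic {S : Type*} [MetricSpace S] (lam C ℓ : ℝ) (p : ℝ → S) : Prop :=
  ContinuousOn p (Set.Icc 0 ℓ) ∧
  ∀ s ∈ Set.Icc 0 ℓ, ∀ t ∈ Set.Icc 0 ℓ,
    dist s t / lam - C ≤ dist (p s) (p t) ∧ dist (p s) (p t) ≤ lam * dist s t + C

/-- A subset `T` of a metric space is *Morse* if for all `lam ≥ 1`, `C ≥ 0` there is `N` such that
every `(lam, C)`-quasi-geodesic connecting two points of `T` lies in the `N`-neighbourhood of `T`. -/
def IsMorse {S : Type*} [MetricSpace S] (T : Set S) : Prop :=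
  ∀ lam C : ℝ, 1 ≤ lam → 0 ≤ C → ∃ N : ℝ, ∀ (ℓ : ℝ) (p : ℝ → S), 0 ≤ ℓ →
    IsQuasiGeodesic lam C ℓ p → p 0 ∈ T → p ℓ ∈ T →
    ∀ t ∈ Set.Icc 0 ℓ, ∃ y ∈ T, dist (p t) y ≤ N

/-- `H` is strongly quasi-convex in `G` with respect to the generating set `X` if it is a Morse
subset of the Cayley graph `Γ(G, X)`. -/
def IsStronglyQuasiConvex {G : Type*} [Group G] (X : Set G) (hX : Subgroup.closure X = ⊤)
    (H : Subgroup G) : Prop :=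
  IsMorse (S := CayleyGraph X hX) (GraphRealization.vertex (mulCayley_connected hX) '' (H : Set G))

/-! ### Asymptotic cones -/

/-- A scaling sequence: an unbounded, strictly increasing sequence of positive real numbers. -/
structure ScalingSequence where
  toFun : ℕ → ℝ
  pos : ∀ i, 0 < toFun i
  strictMono : StrictMono toFun
  unbounded : ¬ BddAbove (Set.range toFun)

instance : CoeFun ScalingSequence (fun _ => ℕ → ℝ) := ⟨ScalingSequence.toFun⟩

/-- The sequences `x` in `S` for which `d(z i, x i) / c i` is bounded, where `z` is the observation
point. The ultrafilter `ω` is recorded in the type because the pseudo-metric depends on it. -/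
structure ConeSequence (S : Type*) [MetricSpace S] (ω : Ultrafilter ℕ) (c : ScalingSequence)
    (z : ℕ → S) where
  seq : ℕ → S
  bounded : BddAbove (Set.range fun i => dist (z i) (seq i) / c i)

namespace ConeSequence

variable {S : Type*} [MetricSpace S] {ω : Ultrafilter ℕ} {c : ScalingSequence} {z : ℕ → S}

/-- The pseudo-metric `d*(x, y) = lim_ω d(x i, y i) / c i`. -/
def limDist (x y : ConeSequence S ω c z) : ℝ :=
  limUnder (ω : Filter ℕ) fun i => dist (x.seq i) (y.seq i) / c i

/-- The limit defining `d*` exists. -/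
lemma tendsto_limDist (x y : ConeSequence S ω c z) :
    Tendsto (fun i => dist (x.seq i) (y.seq i) / c i) (ω : Filter ℕ) (𝓝 (limDist x y)) := by
  obtain ⟨A, hA⟩ := x.bounded
  obtain ⟨B, hB⟩ := y.bounded
  refine tendsto_nhds_limUnder ?_
  have hmem : ∀ i, dist (x.seq i) (y.seq i) / c i ∈ Set.Icc (0 : ℝ) (A + B) := by
    intro i
    have hc := c.pos i
    refine ⟨by positivity, ?_⟩
    have h1 := hA (Set.mem_range_self i)
    have h2 := hB (Set.mem_range_self i)
    refine le_trans ?_ (add_le_add h1 h2)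
    rw [← add_div]
    gcongr
    exact dist_triangle_left _ _ _
  obtain ⟨r, -, hr⟩ := isCompact_Icc.ultrafilter_le_nhds
    (ω.map fun i => dist (x.seq i) (y.seq i) / c i)
    (le_principal_iff.mpr (Ultrafilter.mem_coe.mpr
      (Ultrafilter.mem_map.mpr (Filter.univ_mem' hmem))))
  exact ⟨r, hr⟩

instance : PseudoMetricSpace (ConeSequence S ω c z) where
  dist := limDist
  dist_self x := by
    refine tendsto_nhds_unique (tendsto_limDist x x) ?_
    simp
  dist_comm x y := by
    simp only [limDist, dist_comm]
  dist_triangle x y w := by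
    refine le_of_tendsto_of_tendsto' (tendsto_limDist x w)
      ((tendsto_limDist x y).add (tendsto_limDist y w)) fun i => ?_
    have hc := c.pos i
    rw [← add_div]
    gcongr
    exact dist_triangle _ _ _

end ConeSequence

/-- The asymptotic cone of the metric space `S` with respect to the ultrafilter `ω`, the scaling
sequence `c` and the observation point `z`: the metric quotient of the pseudo-metric `d*`. -/
abbrev AsymptoticCone (S : Type*) [MetricSpace S] (ω : Ultrafilter ℕ) (c : ScalingSequence)
    (z : ℕ → S) : Type _ :=
  SeparationQuotient (ConeSequence S ω c z)

/-- The asymptotic cone of the group `G` for the word metric of the generating set `X`, with the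
identity of `G` as its observation point. -/
abbrev GroupAsymptoticCone {G : Type*} [Group G] (X : Set G) (hX : Subgroup.closure X = ⊤)
    (ω : Ultrafilter ℕ) (c : ScalingSequence) : Type _ :=
  AsymptoticCone (WordMetricSpace X hX) ω c (fun _ => ⟨1⟩)

/-- A cut point of a topological space: the space is connected, and is no longer connected once the
point is removed. -/
def IsCutPoint {S : Type*} [TopologicalSpace S] (p : S) : Prop :=
  ConnectedSpace S ∧ ¬ IsPreconnected ({p}ᶜ : Set S)

end

/-!
Write `|g|` for the word length and `A` for the set of vertices of the Cayley graph that have `1`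
as a nearest point of `H`, so that `|v| = d(v, H)` for `v ∈ A`. The base point `p` of the cone is
a cut point: it separates a point `x` that projects to `p` from a point `q ≠ p` of the limit of
`H`. Such points exist because `H` has infinite index, which gives elements of `A` of every length
(`exists_mem_nearestTo_dist_eq`), and because an infinite strongly quasi-convex subgroup has
elements of every length up to a bounded error (`IsStronglyQuasiConvex.exists_mem_dist`).

If the complement of `p` were connected, then `x` and `q` would be joined in it by a finite chain
whose steps are short compared to the distance from `p` (`IsPreconnected.compl_singleton_subset`).
At scale `c i` in the group this chain yields quasi-geodesics from `1` to `H` whose constants do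
not depend on `i`. The first one is a geodesic from `1` to a representative of `x`, which lies in
`A`. To pass to the next point `y` of the chain, the path is cut at its point nearest to `y` and
continued by a geodesic to `y`; this changes the constant `L` to `2 L + 1`
(`IsDiscreteQuasiGeodesic.exists_extend`), and all the new vertices stay away from `1` by a
definite multiple of `c i`. Since the number of steps is fixed, so is the final constant. The
final path starts at `1` and ends in `H` far from `1`, and where it leaves the ball of radius
`δ c i` about `1` it is in `A`, hence at distance about `δ c i` from `H`. As `c i` is unbounded, this
contradicts the Morse property (`ReachableAvoiding.le_of_isMorse`).

All estimates are made in the word metric of `X`; the cone is that of another generating set `Y`,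
and only the bi-Lipschitz equivalence of the two word metrics is needed
(`exists_mulCayley_dist_le_mul`). The cone itself is connected because geodesics of the group
converge to paths in it (`connectedSpace_groupAsymptoticCone`).
-/

/-! ### Paths in a graph and in its realization -/

namespace GraphRealization

variable {V : Type*} {Γ : SimpleGraph V} {hΓ : Γ.Connected}

lemma dist_vertex_right (x : GraphRealization Γ hΓ) (a : V) :
    dist x (vertex hΓ a) = x.distToVertex a := by
  have h1 := pathDist_le_route x (vertex hΓ a) a
  have h2 := distToVertex_le_pathDist_add x (vertex hΓ a) a
  rw [distToVertex_vertex_self, add_zero] at h1 h2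
  exact le_antisymm h1 h2

lemma dist_vertex_vertex (a b : V) : dist (vertex hΓ a) (vertex hΓ b) = Γ.dist a b := by
  rw [dist_vertex_right]
  refine le_antisymm ?_ ?_
  · simpa [vertex] using (vertex hΓ a).distToVertex_le (u := a) (by simp [vertex]) b
  · have h := dist_le_distToVertex_add (vertex hΓ a) a b
    rwa [distToVertex_vertex_self, zero_add] at h

lemma eq_or_adj_of_dist_le_one (hΓ : Γ.Connected) {u v : V} (h : Γ.dist u v ≤ 1) :
    u = v ∨ Γ.Adj u v := by
  rcases Nat.le_one_iff_eq_zero_or_eq_one.mp h with h | h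
  · exact Or.inl (hΓ.dist_eq_zero_iff.mp h)
  · exact Or.inr (SimpleGraph.dist_eq_one_iff_adj.mp h)

/-- The point `(1 - t) u + t v` of the realization, for vertices `u`, `v` at distance at most
one. -/
noncomputable def edgePoint (hΓ : Γ.Connected) {u v : V} (h : Γ.dist u v ≤ 1) (t : ℝ)
    (ht : t ∈ Set.Icc (0 : ℝ) 1) : GraphRealization Γ hΓ where
  coord := Finsupp.single u (1 - t) + Finsupp.single v t
  mem_edge := ⟨u, v, eq_or_adj_of_dist_le_one hΓ h, t, ht, rfl⟩

lemma dist_edgePoint_le {u v : V} (h : Γ.dist u v ≤ 1) {s t : ℝ} (hs : s ∈ Set.Icc (0 : ℝ) 1)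
    (ht : t ∈ Set.Icc (0 : ℝ) 1) :
    dist (edgePoint hΓ h s hs) (edgePoint hΓ h t ht) ≤ |s - t| := by
  classical
  have := hΓ.nonempty
  have hc : OnCommonEdge (edgePoint hΓ h s hs) (edgePoint hΓ h t ht) := by
    refine ⟨u, v, eq_or_adj_of_dist_le_one hΓ h, fun a ha => ?_⟩
    by_contra! hne
    simp [edgePoint, Finsupp.single_eq_of_ne hne.1, Finsupp.single_eq_of_ne hne.2] at ha
  change pathDist _ _ ≤ _
  rw [pathDist, if_pos hc]
  refine ciSup_le fun a => ?_
  simp only [edgePoint, Finsupp.add_apply, Finsupp.single_apply]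
  have := abs_sub_comm s t
  split_ifs
  · simp
  · rw [show 1 - s + 0 - (1 - t + 0) = t - s by ring, this]
  · simp
  · simp

lemma edgePoint_zero {u v : V} (h : Γ.dist u v ≤ 1) (h0 : (0 : ℝ) ∈ Set.Icc (0 : ℝ) 1) :
    edgePoint hΓ h 0 h0 = vertex hΓ u := by
  refine GraphRealization.ext ?_
  simp [edgePoint, vertex]

lemma edgePoint_one {u v : V} (h : Γ.dist u v ≤ 1) (h1 : (1 : ℝ) ∈ Set.Icc (0 : ℝ) 1) :
    edgePoint hΓ h 1 h1 = vertex hΓ v := by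
  refine GraphRealization.ext ?_
  simp [edgePoint, vertex]

lemma fract_mem_Icc (t : ℝ) : Int.fract t ∈ Set.Icc (0 : ℝ) 1 :=
  ⟨Int.fract_nonneg t, (Int.fract_lt_one t).le⟩

/-- The path in the realization that runs at unit speed along the edges `f k`, `f (k + 1)`; it
pauses for unit time where `f k = f (k + 1)`. Only its restriction to `t ≥ 0` is meaningful. -/
noncomputable def interpolate (hΓ : Γ.Connected) {f : ℕ → V}
    (hf : ∀ k, Γ.dist (f k) (f (k + 1)) ≤ 1) (t : ℝ) : GraphRealization Γ hΓ :=
  edgePoint hΓ (hf ⌊t⌋₊) (Int.fract t) (fract_mem_Icc t)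

variable {f : ℕ → V} (hf : ∀ k, Γ.dist (f k) (f (k + 1)) ≤ 1)

lemma interpolate_natCast (n : ℕ) : interpolate hΓ hf n = vertex hΓ (f n) := by
  refine GraphRealization.ext ?_
  simp [interpolate, edgePoint, vertex]

lemma dist_vertex_interpolate_le {t : ℝ} (ht : 0 ≤ t) :
    dist (vertex hΓ (f ⌊t⌋₊)) (interpolate hΓ hf t) ≤ t - ⌊t⌋₊ := by
  have h0 : (0 : ℝ) ∈ Set.Icc (0 : ℝ) 1 := by simp
  rw [← edgePoint_zero (hf ⌊t⌋₊) h0, interpolate]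
  refine (dist_edgePoint_le _ h0 _).trans_eq ?_
  rw [zero_sub, abs_neg, abs_of_nonneg (Int.fract_nonneg t), Int.fract,
    natCast_floor_eq_intCast_floor ht]

lemma dist_interpolate_vertex_le {t : ℝ} (ht : 0 ≤ t) :
    dist (interpolate hΓ hf t) (vertex hΓ (f (⌊t⌋₊ + 1))) ≤ ⌊t⌋₊ + 1 - t := by
  have h1 : (1 : ℝ) ∈ Set.Icc (0 : ℝ) 1 := by simp
  rw [← edgePoint_one (hf ⌊t⌋₊) h1, interpolate]
  refine (dist_edgePoint_le _ _ h1).trans_eq ?_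
  rw [abs_sub_comm, abs_of_nonneg (by linarith [Int.fract_lt_one t]), Int.fract,
    natCast_floor_eq_intCast_floor ht]
  ring

end GraphRealization

namespace SimpleGraph

variable {V : Type*} {Γ : SimpleGraph V}

lemma Connected.dist_le_sub_of_step (hΓ : Γ.Connected) {f : ℕ → V}
    (hf : ∀ k, Γ.dist (f k) (f (k + 1)) ≤ 1) {i j : ℕ} (hij : i ≤ j) :
    Γ.dist (f i) (f j) ≤ j - i := by
  induction j, hij using Nat.le_induction with
  | base => simp
  | succ j hij ih =>
    have := hΓ.dist_triangle (u := f i) (v := f j) (w := f (j + 1))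
    have := hf j
    omega

/-- Any two vertices are joined by a geodesic. It is extended to all of `ℕ` with steps of length at
most one, so that it can be appended to other paths. -/
lemma Connected.exists_geodesic (hΓ : Γ.Connected) (a b : V) :
    ∃ f : ℕ → V, f 0 = a ∧ f (Γ.dist a b) = b ∧ (∀ k, Γ.dist (f k) (f (k + 1)) ≤ 1) ∧
      ∀ i j, i ≤ j → j ≤ Γ.dist a b → Γ.dist (f i) (f j) = j - i := by
  obtain ⟨p, hp⟩ := hΓ.exists_walk_length_eq_dist a b
  have hstep : ∀ k, Γ.dist (p.getVert k) (p.getVert (k + 1)) ≤ 1 := by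
    intro k
    by_cases hk : k < p.length
    · exact (dist_eq_one_iff_adj.mpr (p.adj_getVert_succ hk)).le
    · rw [p.getVert_of_length_le (by omega), p.getVert_of_length_le (by omega)]
      simp
  have h0 : p.getVert 0 = a := p.getVert_zero
  have h1 : p.getVert (Γ.dist a b) = b := hp ▸ p.getVert_length
  refine ⟨p.getVert, h0, h1, hstep, fun i j hij hj => ?_⟩
  have e1 := hΓ.dist_le_sub_of_step hstep (Nat.zero_le i)
  have e2 := hΓ.dist_le_sub_of_step hstep hij
  have e3 := hΓ.dist_le_sub_of_step hstep hj
  have t1 := hΓ.dist_triangle (u := a) (v := p.getVert i) (w := b)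
  have t2 := hΓ.dist_triangle (u := p.getVert i) (v := p.getVert j) (w := b)
  rw [h0] at e1
  rw [h1] at e3
  omega

end SimpleGraph

namespace GraphRealization

variable {V : Type*} {Γ : SimpleGraph V} {hΓ : Γ.Connected}
variable {f : ℕ → V} (hf : ∀ k, Γ.dist (f k) (f (k + 1)) ≤ 1)

lemma dist_interpolate_le_of_le {s t : ℝ} (hs : 0 ≤ s) (hst : s ≤ t) :
    dist (interpolate hΓ hf s) (interpolate hΓ hf t) ≤ t - s := by
  have ht := hs.trans hst
  have hfl : ⌊s⌋₊ ≤ ⌊t⌋₊ := Nat.floor_mono hst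
  rcases hfl.eq_or_lt with h | h
  · have key : interpolate hΓ hf t = edgePoint hΓ (hf ⌊s⌋₊) (Int.fract t) (fract_mem_Icc t) := by
      unfold interpolate; congr 1 <;> rw [h]
    rw [key, interpolate]
    refine (dist_edgePoint_le _ _ _).trans_eq ?_
    have : Int.fract s - Int.fract t = s - t := by
      rw [Int.fract, Int.fract, ← natCast_floor_eq_intCast_floor hs,
        ← natCast_floor_eq_intCast_floor ht, h]
      ring
    rw [this, abs_sub_comm, abs_of_nonneg (by linarith)]
  · have h1 := dist_interpolate_vertex_le (hΓ := hΓ) hf hs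
    have h2 := dist_vertex_interpolate_le (hΓ := hΓ) hf ht
    have h3 : dist (vertex hΓ (f (⌊s⌋₊ + 1))) (vertex hΓ (f ⌊t⌋₊)) ≤ (⌊t⌋₊ : ℝ) - (⌊s⌋₊ + 1) := by
      rw [dist_vertex_vertex]
      have := hΓ.dist_le_sub_of_step hf h
      have h4 : Γ.dist (f (⌊s⌋₊ + 1)) (f ⌊t⌋₊) + (⌊s⌋₊ + 1) ≤ ⌊t⌋₊ := by
        have : ⌊s⌋₊ + 1 ≤ ⌊t⌋₊ := h
        simp only [Nat.succ_eq_add_one] at *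
        omega
      have h4' : (Γ.dist (f (⌊s⌋₊ + 1)) (f ⌊t⌋₊) : ℝ) + (⌊s⌋₊ + 1) ≤ ⌊t⌋₊ := by exact_mod_cast h4
      linarith
    have := dist_triangle4 (interpolate hΓ hf s) (vertex hΓ (f (⌊s⌋₊ + 1))) (vertex hΓ (f ⌊t⌋₊))
      (interpolate hΓ hf t)
    linarith

lemma dist_interpolate_le {s t : ℝ} (hs : 0 ≤ s) (ht : 0 ≤ t) :
    dist (interpolate hΓ hf s) (interpolate hΓ hf t) ≤ dist s t := by
  rw [Real.dist_eq]
  rcases le_total s t with h | h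
  · rw [abs_sub_comm, abs_of_nonneg (by linarith)]
    exact dist_interpolate_le_of_le hf hs h
  · rw [dist_comm, abs_of_nonneg (by linarith)]
    exact dist_interpolate_le_of_le hf ht h

end GraphRealization

/-! ### Discrete quasi-geodesics -/

/-- The vertices `f 0, …, f n` form an edge path (possibly pausing at a vertex) on which the length
of any piece is at most `L` times the distance of its ends. The condition on steps is imposed at all
times, so that such an `f` can be restricted and continued freely. -/
structure IsDiscreteQuasiGeodesic {V : Type*} (Γ : SimpleGraph V) (L n : ℕ) (f : ℕ → V) :
    Prop where
  step : ∀ k, Γ.dist (f k) (f (k + 1)) ≤ 1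
  le_mul_dist : ∀ i j, i ≤ j → j ≤ n → j - i ≤ L * Γ.dist (f i) (f j)

namespace IsDiscreteQuasiGeodesic

open GraphRealization

variable {V : Type*} {Γ : SimpleGraph V} {L n : ℕ} {f : ℕ → V}

lemma isQuasiGeodesic_interpolate (h : IsDiscreteQuasiGeodesic Γ L n f) (hΓ : Γ.Connected)
    (hL : 1 ≤ L) : IsQuasiGeodesic (L : ℝ) 3 n (interpolate hΓ h.step) := by
  have hL' : (1 : ℝ) ≤ L := by exact_mod_cast hL
  -- rounding the times down to integers costs `1` at either end and `1` in the length
  have lower : ∀ s t : ℝ, 0 ≤ s → s ≤ t → t ≤ n →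
      (t - s) / L - 3 ≤ dist (interpolate hΓ h.step s) (interpolate hΓ h.step t) := by
    intro s t hs hst htn
    have ht := hs.trans hst
    have hfl : ⌊s⌋₊ ≤ ⌊t⌋₊ := Nat.floor_mono hst
    have h1 := dist_vertex_interpolate_le (hΓ := hΓ) h.step hs
    have h2 := dist_vertex_interpolate_le (hΓ := hΓ) h.step ht
    have h3 := h.le_mul_dist _ _ hfl (Nat.floor_le_of_le htn)
    have h4 : ((⌊t⌋₊ : ℝ) - ⌊s⌋₊) ≤ L * Γ.dist (f ⌊s⌋₊) (f ⌊t⌋₊) := by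
      rw [← Nat.cast_sub hfl]; exact_mod_cast h3
    have h5 := dist_triangle4 (vertex hΓ (f ⌊s⌋₊)) (interpolate hΓ h.step s)
      (interpolate hΓ h.step t) (vertex hΓ (f ⌊t⌋₊))
    rw [dist_vertex_vertex, dist_comm _ (vertex hΓ (f ⌊t⌋₊))] at h5
    have b1 := Nat.lt_floor_add_one s
    have b2 := Nat.lt_floor_add_one t
    have b3 := Nat.floor_le hs
    have h6 : (Γ.dist (f ⌊s⌋₊) (f ⌊t⌋₊) : ℝ) - 2 ≤
        dist (interpolate hΓ h.step s) (interpolate hΓ h.step t) := by linarith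
    refine le_trans ?_ h6
    suffices (t - s) / L ≤ Γ.dist (f ⌊s⌋₊) (f ⌊t⌋₊) + 1 by linarith
    rw [div_le_iff₀ (by linarith)]
    nlinarith
  refine ⟨?_, fun s hs t ht => ⟨?_, ?_⟩⟩
  · have : LipschitzOnWith 1 (interpolate hΓ h.step) (Set.Icc 0 (n : ℝ)) :=
      LipschitzOnWith.of_dist_le_mul fun s hs t ht => by
        simpa using dist_interpolate_le h.step hs.1 ht.1
    exact this.continuousOn
  · rw [Real.dist_eq]
    rcases le_total s t with hst | hst
    · rw [abs_sub_comm, abs_of_nonneg (by linarith)]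
      exact lower s t hs.1 hst ht.2
    · rw [abs_of_nonneg (by linarith), dist_comm (interpolate hΓ h.step s)]
      exact lower t s ht.1 hst hs.2
  · have h1 := dist_interpolate_le (hΓ := hΓ) h.step hs.1 ht.1
    have h2 : (0 : ℝ) ≤ dist s t := dist_nonneg
    nlinarith

end IsDiscreteQuasiGeodesic

/-- The Morse property, read off on vertices. -/
lemma IsMorse.exists_dist_le {V : Type*} {Γ : SimpleGraph V} {hΓ : Γ.Connected} {T : Set V}
    (hT : IsMorse (GraphRealization.vertex hΓ '' T)) {L : ℕ} (hL : 1 ≤ L) :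
    ∃ N : ℕ, ∀ (n : ℕ) (f : ℕ → V), IsDiscreteQuasiGeodesic Γ L n f → f 0 ∈ T → f n ∈ T →
      ∀ k ≤ n, ∃ y ∈ T, Γ.dist (f k) y ≤ N := by
  obtain ⟨N, hN⟩ := hT L 3 (by exact_mod_cast hL) (by norm_num)
  refine ⟨⌊N⌋₊, fun n f hf h0 hn k hk => ?_⟩
  have e : ∀ m : ℕ, GraphRealization.interpolate hΓ hf.step m = GraphRealization.vertex hΓ (f m) :=
    GraphRealization.interpolate_natCast hf.step
  obtain ⟨_, ⟨y, hy, rfl⟩, hd⟩ := hN n _ (Nat.cast_nonneg n) (hf.isQuasiGeodesic_interpolate hΓ hL)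
    ⟨f 0, h0, by simpa using (e 0).symm⟩ ⟨f n, hn, (e n).symm⟩ k
    ⟨Nat.cast_nonneg k, by exact_mod_cast hk⟩
  rw [e, GraphRealization.dist_vertex_vertex] at hd
  exact ⟨y, hy, Nat.le_floor hd⟩

namespace IsDiscreteQuasiGeodesic

variable {V : Type*} {Γ : SimpleGraph V} {L n : ℕ} {f : ℕ → V}

/-- Cutting a quasi-geodesic at its point nearest to `x` and continuing along a geodesic to `x`
gives a quasi-geodesic: for `u` before the corner `m` and `v` after it, `d(m, v) ≤ d(u, v)`. Every
new point is as close to `x` as the old end was. -/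
lemma exists_extend (hf : IsDiscreteQuasiGeodesic Γ L n f) (hΓ : Γ.Connected) (x : V) :
    ∃ (n' : ℕ) (f' : ℕ → V), IsDiscreteQuasiGeodesic Γ (2 * L + 1) n' f' ∧ f' 0 = f 0 ∧
      f' n' = x ∧ ∀ k ≤ n', (∃ m ≤ n, f' k = f m) ∨ Γ.dist (f' k) x ≤ Γ.dist (f n) x := by
  obtain ⟨m, hm, hmin⟩ := Finset.exists_min_image (Finset.range (n + 1))
    (fun k => Γ.dist (f k) x) ⟨0, by simp⟩
  simp only [Finset.mem_range, Nat.lt_succ_iff] at hm hmin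
  obtain ⟨g, g0, g1, gstep, gdist⟩ := hΓ.exists_geodesic (f m) x
  set d := Γ.dist (f m) x with hd
  have old : ∀ k, k ≤ m → (fun k => if k ≤ m then f k else g (k - m)) k = f k :=
    fun k hk => if_pos hk
  have new : ∀ k, m ≤ k → (fun k => if k ≤ m then f k else g (k - m)) k = g (k - m) := by
    intro k hk
    rcases hk.eq_or_lt with rfl | hk
    · simp [g0]
    · exact if_neg (by omega)
  generalize (fun k => if k ≤ m then f k else g (k - m)) = f' at old new
  refine ⟨m + d, f', ⟨fun k => ?_, fun i j hij hj => ?_⟩, old 0 (Nat.zero_le _), ?_,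
    fun k hk => ?_⟩
  · rcases lt_or_ge k m with hk | hk
    · rw [old k hk.le, old (k + 1) hk]; exact hf.step k
    · rw [new k hk, new (k + 1) (by omega), show k + 1 - m = k - m + 1 by omega]; exact gstep _
  · rcases le_total j m with hjm | hjm
    · rw [old i (hij.trans hjm), old j hjm]
      exact (hf.le_mul_dist i j hij (hjm.trans hm)).trans (Nat.mul_le_mul_right _ (by omega))
    rcases le_total m i with him | him
    · rw [new i him, new j hjm, gdist _ _ (by omega) (by omega)]
      have : (2 * L + 1) * (j - m - (i - m)) = 2 * (L * (j - m - (i - m))) + (j - m - (i - m)) := by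
        ring
      omega
    · rw [old i him, new j hjm]
      have h1 := hf.le_mul_dist i m him hm
      have h2 := gdist 0 (j - m) (by omega) (by omega)
      have h3 := gdist (j - m) d (by omega) le_rfl
      have h4 := hmin i (him.trans hm)
      rw [g1] at h3
      rw [g0] at h2
      have t1 := hΓ.dist_triangle (u := f i) (v := g (j - m)) (w := x)
      have t2 := hΓ.dist_triangle (u := f i) (v := g (j - m)) (w := f m)
      rw [SimpleGraph.dist_comm (u := g (j - m)) (v := f m)] at t2
      -- `h4` is the choice of `m`, and gives `d(f m, g (j - m)) ≤ d(f i, g (j - m))`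
      have h5 : Γ.dist (f i) (f m) ≤ 2 * Γ.dist (f i) (g (j - m)) := by omega
      have h6 : L * Γ.dist (f i) (f m) ≤ L * (2 * Γ.dist (f i) (g (j - m))) :=
        Nat.mul_le_mul_left _ h5
      have : (2 * L + 1) * Γ.dist (f i) (g (j - m)) =
        L * (2 * Γ.dist (f i) (g (j - m))) + Γ.dist (f i) (g (j - m)) := by ring
      omega
  · rw [new _ (by omega), Nat.add_sub_cancel_left, g1]
  · rcases le_total k m with hkm | hkm
    · exact Or.inl ⟨k, hkm.trans hm, old k hkm⟩
    · right
      have h1 := gdist (k - m) d (by omega) le_rfl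
      rw [g1] at h1
      have := hmin n le_rfl
      rw [new k hkm]
      omega

end IsDiscreteQuasiGeodesic

/-- The vertices for which `o`, a point of `T`, is a nearest point of `T`. -/
def nearestTo {V : Type*} (Γ : SimpleGraph V) (T : Set V) (o : V) : Set V :=
  {v | ∀ y ∈ T, Γ.dist o v ≤ Γ.dist v y}

lemma mem_nearestTo_of_dist_add_eq {V : Type*} {Γ : SimpleGraph V} (hΓ : Γ.Connected) {T : Set V}
    {o v w : V} (hw : w ∈ nearestTo Γ T o) (h : Γ.dist o v + Γ.dist v w = Γ.dist o w) :
    v ∈ nearestTo Γ T o := by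
  intro y hy
  have h1 := hw y hy
  have h2 := hΓ.dist_triangle (u := w) (v := v) (w := y)
  rw [SimpleGraph.dist_comm (u := w) (v := v)] at h2
  omega

/-- `x` is joined to `o` by a quasi-geodesic with constant `L`, all of whose points within distance
less than `r` of `o` project to `o` in `T`. -/
def ReachableAvoiding {V : Type*} (Γ : SimpleGraph V) (T : Set V) (o : V) (L : ℕ) (r : ℝ) (x : V) :
    Prop :=
  ∃ (n : ℕ) (f : ℕ → V), IsDiscreteQuasiGeodesic Γ L n f ∧ f 0 = o ∧ f n = x ∧
    ∀ k ≤ n, r ≤ Γ.dist o (f k) ∨ f k ∈ nearestTo Γ T o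

namespace ReachableAvoiding

variable {V : Type*} {Γ : SimpleGraph V} {T : Set V} {o x y : V} {L : ℕ} {r : ℝ}

lemma of_mem_nearestTo (hΓ : Γ.Connected) (hx : x ∈ nearestTo Γ T o) :
    ReachableAvoiding Γ T o 1 r x := by
  obtain ⟨g, g0, g1, gstep, gdist⟩ := hΓ.exists_geodesic o x
  refine ⟨_, g, ⟨gstep, fun i j hij hj => by rw [gdist i j hij hj, one_mul]⟩, g0, g1,
    fun k hk => Or.inr (mem_nearestTo_of_dist_add_eq hΓ hx ?_)⟩
  have h1 := gdist 0 k (Nat.zero_le _) hk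
  have h2 := gdist k _ hk le_rfl
  rw [g0] at h1
  rw [g1] at h2
  omega

lemma mono (h : ReachableAvoiding Γ T o L r x) {r' : ℝ} (hr : r' ≤ r) :
    ReachableAvoiding Γ T o L r' x := by
  obtain ⟨n, f, hf, h0, hn, hfar⟩ := h
  exact ⟨n, f, hf, h0, hn, fun k hk => (hfar k hk).imp_left hr.trans⟩

lemma extend (h : ReachableAvoiding Γ T o L r x) (hΓ : Γ.Connected) {r' : ℝ} (hr : r' ≤ r)
    (hxy : Γ.dist x y + r' ≤ Γ.dist o y) : ReachableAvoiding Γ T o (2 * L + 1) r' y := by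
  obtain ⟨n, f, hf, h0, hn, hfar⟩ := h
  obtain ⟨n', f', hf', h0', hn', hk'⟩ := hf.exists_extend hΓ y
  refine ⟨n', f', hf', h0'.trans h0, hn', fun k hk => ?_⟩
  rcases hk' k hk with ⟨m, hm, e⟩ | hd
  · rw [e]; exact (hfar m hm).imp_left hr.trans
  · left
    rw [hn] at hd
    have t := hΓ.dist_triangle (u := o) (v := f' k) (w := y)
    have hd' : (Γ.dist (f' k) y : ℝ) ≤ Γ.dist x y := by exact_mod_cast hd
    have t' : (Γ.dist o y : ℝ) ≤ Γ.dist o (f' k) + Γ.dist (f' k) y := by exact_mod_cast t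
    linarith

/-- A Morse set cannot be reached far from `o` along such a quasi-geodesic: the last point before
the path leaves the `r`-ball around `o` has distance about `r` from `T`. -/
lemma le_of_isMorse {hΓ : Γ.Connected} (hT : IsMorse (GraphRealization.vertex hΓ '' T))
    (ho : o ∈ T) (hL : 1 ≤ L) :
    ∃ N : ℕ, ∀ (r : ℝ) (x : V), ReachableAvoiding Γ T o L r x → x ∈ T → r ≤ Γ.dist o x →
      r ≤ N + 1 := by
  classical
  obtain ⟨N, hN⟩ := hT.exists_dist_le hL
  refine ⟨N, ?_⟩
  rintro r x ⟨n, f, hf, h0, rfl, hfar⟩ hx hr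
  have hex : ∃ k, r ≤ Γ.dist o (f k) := ⟨n, hr⟩
  have hmin := fun m => Nat.find_min (m := m) hex
  have hspec := Nat.find_spec hex
  have hle : Nat.find hex ≤ n := Nat.find_min' hex hr
  rcases hk : Nat.find hex with _ | k
  · rw [hk, h0, SimpleGraph.dist_self] at hspec
    have : (0 : ℝ) ≤ N := Nat.cast_nonneg N
    push_cast at hspec
    linarith
  · rw [hk] at hspec hmin hle
    have hA := (hfar k (by omega)).resolve_left (hmin k (by omega))
    obtain ⟨y, hy, hd⟩ := hN n f hf (h0 ▸ ho) hx k (by omega)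
    have h1 := hA y hy
    have h2 := hf.step k
    have h3 := hΓ.dist_triangle (u := o) (v := f k) (w := f (k + 1))
    have h4 : Γ.dist o (f (k + 1)) ≤ N + 1 := by omega
    exact hspec.trans (by exact_mod_cast h4)

end ReachableAvoiding

/-! ### Word metrics -/

section WordMetric

variable {G : Type*} [Group G] {X : Set G}

lemma mulCayley_dist_mul_left (hX : Subgroup.closure X = ⊤) (a g h : G) :
    (SimpleGraph.mulCayley X).dist (a * g) (a * h) = (SimpleGraph.mulCayley X).dist g h := by
  have key : ∀ a g h : G,
      (SimpleGraph.mulCayley X).dist (a * g) (a * h) ≤ (SimpleGraph.mulCayley X).dist g h := by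
    intro a g h
    obtain ⟨p, hp⟩ := (mulCayley_connected hX).exists_walk_length_eq_dist g h
    let φ : SimpleGraph.mulCayley X →g SimpleGraph.mulCayley X :=
      ⟨fun b => a * b, fun hb => SimpleGraph.mulCayley_adj_mul_iff_right.mpr hb⟩
    rw [← hp, ← p.length_map φ]
    exact SimpleGraph.dist_le (p.map φ)
  refine le_antisymm (key a g h) ?_
  simpa using key a⁻¹ (a * g) (a * h)

lemma exists_mulCayley_dist_le_mul (hX : Subgroup.closure X = ⊤) {Y : Set G} (hYfin : Y.Finite)
    (hY : Subgroup.closure Y = ⊤) :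
    ∃ K : ℕ, 1 ≤ K ∧ ∀ g h : G,
      (SimpleGraph.mulCayley X).dist g h ≤ K * (SimpleGraph.mulCayley Y).dist g h := by
  obtain ⟨K, hK⟩ := (hYfin.image fun y => (SimpleGraph.mulCayley X).dist 1 y).bddAbove
  refine ⟨K + 1, by omega, fun g h => ?_⟩
  have edge : ∀ u v : G, (SimpleGraph.mulCayley Y).Adj u v →
      (SimpleGraph.mulCayley X).dist u v ≤ K + 1 := by
    intro u v huv
    obtain ⟨-, y, hy, h | h⟩ := (SimpleGraph.mulCayley_adj' Y u v).mp huv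
    · have := hK (Set.mem_image_of_mem _ hy)
      rw [← h, ← mulCayley_dist_mul_left hX u⁻¹]
      simp only [inv_mul_cancel, inv_mul_cancel_left]
      omega
    · have := hK (Set.mem_image_of_mem _ hy)
      rw [h, SimpleGraph.dist_comm, ← mulCayley_dist_mul_left hX v⁻¹]
      simp only [inv_mul_cancel, inv_mul_cancel_left]
      omega
  have walk : ∀ (u v : G) (p : (SimpleGraph.mulCayley Y).Walk u v),
      (SimpleGraph.mulCayley X).dist u v ≤ (K + 1) * p.length := by
    intro u v p
    induction p with
    | nil => simp
    | @cons u v w huv p ih =>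
      have := edge u v huv
      have := (mulCayley_connected hX).dist_triangle (u := u) (v := v) (w := w)
      rw [SimpleGraph.Walk.length_cons, mul_add, mul_one]
      omega
  obtain ⟨p, hp⟩ := (mulCayley_connected hY).exists_walk_length_eq_dist g h
  exact hp ▸ walk g h p

open scoped Pointwise in
lemma finite_mulCayley_ball (hXfin : X.Finite) (hX : Subgroup.closure X = ⊤) (n : ℕ) :
    {g : G | (SimpleGraph.mulCayley X).dist 1 g ≤ n}.Finite := by
  induction n with
  | zero =>
    refine (Set.finite_singleton (1 : G)).subset fun g hg => ?_
    exact ((mulCayley_connected hX).dist_eq_zero_iff.mp (Nat.le_zero.mp hg)).symm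
  | succ n ih =>
    refine (ih.mul (((Set.finite_singleton (1 : G)).union hXfin).union hXfin.inv)).subset ?_
    intro g hg
    obtain ⟨f, f0, f1, fstep, fdist⟩ := (mulCayley_connected hX).exists_geodesic 1 g
    obtain ⟨d, hd⟩ : ∃ d, (SimpleGraph.mulCayley X).dist 1 g = d := ⟨_, rfl⟩
    have hg : (SimpleGraph.mulCayley X).dist 1 g ≤ n + 1 := hg
    rw [hd] at f1 fdist hg
    rcases d with _ | d
    · exact ⟨1, by simp, 1, by simp, by simp [← f0, f1]⟩
    · refine ⟨f d, ?_, (f d)⁻¹ * g, ?_, by simp⟩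
      · have := fdist 0 d (Nat.zero_le _) (by omega)
        rw [f0] at this
        simp only [Set.mem_ofPred_eq]
        omega
      · have h1 := fstep d
        rw [f1] at h1
        rcases GraphRealization.eq_or_adj_of_dist_le_one (mulCayley_connected hX) h1 with e | e
        · simp [e]
        · obtain ⟨-, s, hs, h | h⟩ := (SimpleGraph.mulCayley_adj' X _ _).mp e
          · left; right; rw [← h]; simpa using hs
          · right; rw [h]; simpa using hs

lemma exists_mem_nearestTo_dist_eq (hXfin : X.Finite) (hX : Subgroup.closure X = ⊤) (H : Subgroup G)
    [Infinite (G ⧸ H)] (n : ℕ) :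
    ∃ g ∈ nearestTo (SimpleGraph.mulCayley X) (H : Set G) 1,
      (SimpleGraph.mulCayley X).dist 1 g = n := by
  classical
  have hconn := mulCayley_connected hX
  -- the ball of radius `n` meets only finitely many of the cosets `g⁻¹ H`
  obtain ⟨g, hg⟩ : ∃ g : G, ∀ h ∈ H, n < (SimpleGraph.mulCayley X).dist g h := by
    by_contra! hcon
    have hfin := ((finite_mulCayley_ball hXfin hX n).image (fun g : G => (g : G ⧸ H)))
    refine Set.infinite_univ (hfin.subset fun q _ => ?_)
    induction q using QuotientGroup.induction_on with
    | _ a =>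
      obtain ⟨h, hh, hd⟩ := hcon a⁻¹
      refine ⟨a * h, ?_, ?_⟩
      · rw [← mulCayley_dist_mul_left hX a, mul_inv_cancel] at hd
        exact hd
      · exact QuotientGroup.mk_mul_of_mem a hh
  obtain ⟨h₀, hmin⟩ : ∃ h₀ : H, ∀ h : H,
      (SimpleGraph.mulCayley X).dist g h₀ ≤ (SimpleGraph.mulCayley X).dist g h :=
    ⟨Function.argmin (fun h : H => (SimpleGraph.mulCayley X).dist g h),
      fun h => Function.argmin_le (fun h : H => (SimpleGraph.mulCayley X).dist g h) h⟩
  have e : ∀ h : G, (SimpleGraph.mulCayley X).dist ((h₀ : G)⁻¹ * g) h =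
      (SimpleGraph.mulCayley X).dist g (h₀ * h) := by
    intro h
    rw [← mulCayley_dist_mul_left hX (h₀ : G)]
    simp
  have hA : (h₀ : G)⁻¹ * g ∈ nearestTo (SimpleGraph.mulCayley X) (H : Set G) 1 := by
    intro h hh
    rw [SimpleGraph.dist_comm, e, e, mul_one]
    exact hmin (h₀ * ⟨h, hh⟩)
  have hfar : n < (SimpleGraph.mulCayley X).dist 1 ((h₀ : G)⁻¹ * g) := by
    rw [SimpleGraph.dist_comm, e, mul_one]
    exact hg h₀ h₀.2
  obtain ⟨f, f0, f1, -, fdist⟩ := hconn.exists_geodesic 1 ((h₀ : G)⁻¹ * g)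
  have h1 := fdist 0 n (Nat.zero_le _) hfar.le
  have h2 := fdist n _ hfar.le le_rfl
  rw [f0] at h1
  rw [f1] at h2
  exact ⟨f n, mem_nearestTo_of_dist_add_eq hconn hA (by omega), by omega⟩

/-- An infinite strongly quasi-convex subgroup has no large gaps: its elements occur at every
distance from the identity, up to a bounded error. -/
lemma IsStronglyQuasiConvex.exists_mem_dist (hXfin : X.Finite) (hX : Subgroup.closure X = ⊤)
    {H : Subgroup G} [Infinite H] (hH : IsStronglyQuasiConvex X hX H) :
    ∃ C : ℕ, ∀ n : ℕ, ∃ h ∈ H, n ≤ (SimpleGraph.mulCayley X).dist 1 h ∧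
      (SimpleGraph.mulCayley X).dist 1 h ≤ n + C := by
  have hconn := mulCayley_connected hX
  obtain ⟨N, hN⟩ := IsMorse.exists_dist_le hH le_rfl
  refine ⟨2 * N, fun n => ?_⟩
  have hHinf : (H : Set G).Infinite := Set.infinite_coe_iff.mp ‹_›
  obtain ⟨h, hh, hfar⟩ := hHinf.exists_notMem_finite (finite_mulCayley_ball hXfin hX (n + N))
  have hfar : n + N < (SimpleGraph.mulCayley X).dist 1 h := not_le.mp hfar
  obtain ⟨f, f0, f1, fstep, fdist⟩ := hconn.exists_geodesic 1 h
  obtain ⟨y, hy, hd⟩ := hN _ f ⟨fstep, fun i j hij hj => by rw [fdist i j hij hj, one_mul]⟩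
    (by rw [f0]; exact H.one_mem) (by rw [f1]; exact hh) (n + N) hfar.le
  have h1 := fdist 0 (n + N) (Nat.zero_le _) hfar.le
  rw [f0] at h1
  have t1 := hconn.dist_triangle (u := 1) (v := f (n + N)) (w := y)
  have t2 := hconn.dist_triangle (u := 1) (v := y) (w := f (n + N))
  rw [SimpleGraph.dist_comm (u := y)] at t2
  exact ⟨y, hy, by omega, by omega⟩

end WordMetric

/-! ### Asymptotic cones -/

lemma ScalingSequence.tendsto_atTop (c : ScalingSequence) {ω : Ultrafilter ℕ}
    (hω : ∀ n : ℕ, ω ≠ pure n) : Tendsto c (ω : Filter ℕ) atTop := by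
  have h1 : Tendsto c atTop atTop := tendsto_atTop_atTop_of_monotone' c.strictMono.monotone
    c.unbounded
  rcases ω.le_cofinite_or_eq_pure with h | ⟨n, h⟩
  · exact h1.mono_left (h.trans_eq Nat.cofinite_eq_atTop)
  · exact absurd h (hω n)

lemma IsPreconnected.compl_singleton_subset {M : Type*} [MetricSpace M] {p : M}
    (hp : IsPreconnected ({p}ᶜ : Set M)) {K : ℝ} {S : Set M} (hne : ∃ a ∈ S, a ≠ p)
    (hS : ∀ a ∈ S, ∀ v, K * dist a v < dist p v → v ∈ S) : ({p}ᶜ : Set M) ⊆ S := by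
  have pos : ∀ a, a ≠ p → K * dist a a < dist p a := fun a ha => by
    simpa using dist_pos.mpr (Ne.symm ha)
  -- both `S` and its complement are open in `{p}ᶜ`
  have open1 : IsOpen (S ∩ {p}ᶜ) := by
    refine isOpen_iff_mem_nhds.mpr fun a ha => ?_
    have hop : IsOpen {v | K * dist a v < dist p v} := isOpen_lt (by fun_prop) (by fun_prop)
    filter_upwards [hop.mem_nhds (pos a ha.2), isOpen_compl_singleton.mem_nhds ha.2] with v hv hv'
    exact ⟨hS a ha.1 v hv, hv'⟩
  have open2 : IsOpen (Sᶜ ∩ {p}ᶜ) := by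
    refine isOpen_iff_mem_nhds.mpr fun a ha => ?_
    have hop : IsOpen {v | K * dist v a < dist p a} := isOpen_lt (by fun_prop) (by fun_prop)
    filter_upwards [hop.mem_nhds (pos a ha.2), isOpen_compl_singleton.mem_nhds ha.2] with v hv hv'
    exact ⟨fun h => ha.1 (hS v h a hv), hv'⟩
  intro b hb
  by_contra hbS
  obtain ⟨a, ha, hap⟩ := hne
  obtain ⟨x, -, hx1, hx2⟩ := hp _ _ open1 open2
    (fun x hx => (em (x ∈ S)).imp (fun h => ⟨h, hx⟩) fun h => ⟨h, hx⟩)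
    ⟨a, hap, ha, hap⟩ ⟨b, hb, hbS, hb⟩
  exact hx2.1 hx1.1

section Cone

variable {G : Type*} [Group G] {Y : Set G} {hY : Subgroup.closure Y = ⊤} {ω : Ultrafilter ℕ}
  {c : ScalingSequence}

lemma ConeSequence.eq_of_seq_eq {S : Type*} [MetricSpace S] {z : ℕ → S}
    {u v : ConeSequence S ω c z} (h : u.seq = v.seq) : u = v := by
  cases u; cases v; cases h; rfl

/-- A sequence of group elements whose word lengths are `O(c i)`, as a sequence in the cone. -/
def ConeSequence.ofElements (hY : Subgroup.closure Y = ⊤) (ω : Ultrafilter ℕ) (g : ℕ → G)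
    (B : ℝ) (hg : ∀ i, ((SimpleGraph.mulCayley Y).dist 1 (g i) : ℝ) ≤ B * c i) :
    ConeSequence (WordMetricSpace Y hY) ω c (fun _ => ⟨1⟩) where
  seq i := ⟨g i⟩
  bounded := ⟨B, by
    rintro _ ⟨i, rfl⟩
    exact (div_le_iff₀ (c.pos i)).mpr (hg i)⟩

lemma ConeSequence.tendsto_dist (u v : ConeSequence (WordMetricSpace Y hY) ω c (fun _ => ⟨1⟩)) :
    Tendsto (fun i => ((SimpleGraph.mulCayley Y).dist (u.seq i).elt (v.seq i).elt : ℝ) / c i)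
      (ω : Filter ℕ) (𝓝 (dist u v)) :=
  tendsto_limDist u v

/-- The constant sequence `1`, which represents the base point of the cone. -/
def ConeSequence.base (hY : Subgroup.closure Y = ⊤) (ω : Ultrafilter ℕ) (c : ScalingSequence) :
    ConeSequence (WordMetricSpace Y hY) ω c (fun _ => ⟨1⟩) :=
  ConeSequence.ofElements hY ω (fun _ => 1) 0 (by simp)

/-- Geodesics in the Cayley graph converge to paths in the cone. -/
lemma connectedSpace_groupAsymptoticCone (hY : Subgroup.closure Y = ⊤)
    (hω : ∀ n : ℕ, ω ≠ pure n) : ConnectedSpace (GroupAsymptoticCone Y hY ω c) := by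
  have hconn := mulCayley_connected hY
  have hc := c.tendsto_atTop hω
  have join : ∀ a : GroupAsymptoticCone Y hY ω c, ∃ t : Set (GroupAsymptoticCone Y hY ω c),
      SeparationQuotient.mk (ConeSequence.base hY ω c) ∈ t ∧ a ∈ t ∧ IsPreconnected t := by
    intro a
    obtain ⟨s, rfl⟩ := SeparationQuotient.surjective_mk a
    choose f f0 f1 fstep fdist using fun i => hconn.exists_geodesic 1 (s.seq i).elt
    set d : ℕ → ℕ := fun i => (SimpleGraph.mulCayley Y).dist 1 (s.seq i).elt with hd
    have hfl : ∀ (t : unitInterval) i, ⌊(t : ℝ) * d i⌋₊ ≤ d i := fun t i =>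
      Nat.floor_le_of_le (mul_le_of_le_one_left (Nat.cast_nonneg _) t.2.2)
    obtain ⟨B, hB⟩ := s.bounded
    have hB' : ∀ i, (d i : ℝ) ≤ B * c i := fun i =>
      (div_le_iff₀ (c.pos i)).mp (hB ⟨i, rfl⟩)
    let γ : unitInterval → ConeSequence (WordMetricSpace Y hY) ω c (fun _ => ⟨1⟩) := fun t =>
      ConeSequence.ofElements hY ω (fun i => f i ⌊(t : ℝ) * d i⌋₊) B fun i => by
        have h := fdist i 0 _ (Nat.zero_le _) (hfl t i)
        rw [f0, Nat.sub_zero] at h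
        rw [h]
        exact le_trans (by exact_mod_cast hfl t i) (hB' i)
    have hd_lim : Tendsto (fun i => (d i : ℝ) / c i) (ω : Filter ℕ)
        (𝓝 (dist (ConeSequence.base hY ω c) s)) :=
      ConeSequence.tendsto_dist (ConeSequence.base hY ω c) s
    have key : ∀ t u : unitInterval, t ≤ u →
        dist (γ t) (γ u) ≤ dist (ConeSequence.base hY ω c) s * dist t u := by
      intro t u htu
      have htu' : (t : ℝ) ≤ u := htu
      have hlim : Tendsto (fun i => (d i : ℝ) / c i * (u - t) + (c i)⁻¹) (ω : Filter ℕ)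
          (𝓝 (dist (ConeSequence.base hY ω c) s * (u - t) + 0)) :=
        (hd_lim.mul_const _).add (tendsto_inv_atTop_zero.comp hc)
      rw [add_zero] at hlim
      rw [Subtype.dist_eq, Real.dist_eq, abs_sub_comm, abs_of_nonneg (by linarith)]
      refine le_of_tendsto_of_tendsto' (ConeSequence.tendsto_dist (γ t) (γ u)) hlim fun i => ?_
      have hpos := c.pos i
      have hmono : ⌊(t : ℝ) * d i⌋₊ ≤ ⌊(u : ℝ) * d i⌋₊ := Nat.floor_mono (by gcongr)
      change ((SimpleGraph.mulCayley Y).dist (f i ⌊(t : ℝ) * d i⌋₊)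
        (f i ⌊(u : ℝ) * d i⌋₊) : ℝ) / c i ≤ _
      rw [fdist i _ _ hmono (hfl u i), Nat.cast_sub hmono, div_le_iff₀ hpos]
      have b1 := Nat.lt_floor_add_one ((t : ℝ) * d i)
      have b2 := Nat.floor_le (mul_nonneg u.2.1 (Nat.cast_nonneg (d i)))
      have e : ((d i : ℝ) / c i * (u - t) + (c i)⁻¹) * c i = d i * (u - t) + 1 := by
        field_simp
      rw [e]
      linarith
    have hcont : Continuous fun t =>
        (SeparationQuotient.mk (γ t) : GroupAsymptoticCone Y hY ω c) := by
      refine SeparationQuotient.continuous_mk.comp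
        (LipschitzWith.of_dist_le_mul (K := ⟨dist (ConeSequence.base hY ω c) s, dist_nonneg⟩)
          fun t u => ?_).continuous
      rcases le_total t u with h | h
      · exact key t u h
      · rw [dist_comm, dist_comm t]; exact key u t h
    refine ⟨Set.range fun t => SeparationQuotient.mk (γ t), ⟨0, ?_⟩, ⟨1, ?_⟩,
      isPreconnected_range hcont⟩
    · simp [γ, ConeSequence.base, ConeSequence.ofElements, f0]
    · have : (γ 1).seq = s.seq := by
        funext i
        simp [γ, ConeSequence.ofElements, f1, hd]
      exact congrArg SeparationQuotient.mk (ConeSequence.eq_of_seq_eq this)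
  exact
    { isPreconnected_univ := isPreconnected_of_forall
        (SeparationQuotient.mk (ConeSequence.base hY ω c)) fun a _ =>
          let ⟨t, h1, h2, h3⟩ := join a
          ⟨t, Set.subset_univ t, h1, h2, h3⟩
      toNonempty := ⟨SeparationQuotient.mk (ConeSequence.base hY ω c)⟩ }

/-- The points of the cone that can be reached from the base point by quasi-geodesics in the Cayley
graph of `X` with a uniform constant, on which only points that project to `1` in `H` are closer to
`1` than a definite multiple of the scale. -/
def ConeReachable (X : Set G) (H : Subgroup G)
    (s : ConeSequence (WordMetricSpace Y hY) ω c (fun _ => ⟨1⟩)) : Prop :=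
  ∃ L : ℕ, 1 ≤ L ∧ ∃ δ : ℝ, 0 < δ ∧ ∀ᶠ i in (ω : Filter ℕ),
    ReachableAvoiding (SimpleGraph.mulCayley X) (H : Set G) 1 L (δ * c i) (s.seq i).elt

/-- Reachability propagates over steps that are short compared to the distance from the base point;
`K` bounds the distortion between the two word metrics. -/
lemma ConeReachable.extend {X : Set G} (hX : Subgroup.closure X = ⊤) {H : Subgroup G} {K : ℕ}
    (hK : 1 ≤ K)
    (hXY : ∀ g h, (SimpleGraph.mulCayley X).dist g h ≤ K * (SimpleGraph.mulCayley Y).dist g h)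
    (hYX : ∀ g h, (SimpleGraph.mulCayley Y).dist g h ≤ K * (SimpleGraph.mulCayley X).dist g h)
    {u v : ConeSequence (WordMetricSpace Y hY) ω c (fun _ => ⟨1⟩)} (hu : ConeReachable X H u)
    (huv : (K : ℝ) ^ 2 * dist u v < dist (ConeSequence.base hY ω c) v) : ConeReachable X H v := by
  obtain ⟨L, hL, δ, hδ, hev⟩ := hu
  have hK' : (0 : ℝ) < K := by exact_mod_cast hK
  obtain ⟨ε, hε, hlt⟩ : ∃ ε > 0, (K : ℝ) ^ 2 * dist u v + ε < dist (ConeSequence.base hY ω c) v :=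
    ⟨(dist (ConeSequence.base hY ω c) v - (K : ℝ) ^ 2 * dist u v) / 2, by linarith, by linarith⟩
  refine ⟨2 * L + 1, by omega, min δ (ε / K), lt_min hδ (by positivity), ?_⟩
  have hlim := (((ConeSequence.tendsto_dist u v).const_mul ((K : ℝ) ^ 2)).add_const
    ε).eventually_lt (ConeSequence.tendsto_dist (ConeSequence.base hY ω c) v) hlt
  filter_upwards [hev, hlim] with i hi hi'
  have hpos := c.pos i
  refine hi.extend (mulCayley_connected hX)
    (mul_le_mul_of_nonneg_right (min_le_left _ _) hpos.le) ?_
  have h1 : ((SimpleGraph.mulCayley X).dist (u.seq i).elt (v.seq i).elt : ℝ) ≤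
      K * (SimpleGraph.mulCayley Y).dist (u.seq i).elt (v.seq i).elt := by exact_mod_cast hXY _ _
  have h2 : ((SimpleGraph.mulCayley Y).dist 1 (v.seq i).elt : ℝ) ≤
      K * (SimpleGraph.mulCayley X).dist 1 (v.seq i).elt := by exact_mod_cast hYX _ _
  change (K : ℝ) ^ 2 * (_ / _) + ε <
    ((SimpleGraph.mulCayley Y).dist 1 (v.seq i).elt : ℝ) / c i at hi'
  rw [lt_div_iff₀ hpos] at hi'
  have h3 : min δ (ε / K) * c i ≤ ε / K * c i :=
    mul_le_mul_of_nonneg_right (min_le_right _ _) hpos.le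
  refine le_of_mul_le_mul_left ?_ hK'
  have e1 : (K : ℝ) * (ε / K * c i) = ε * c i := by field_simp
  have e2 : ((K : ℝ) ^ 2 * ((SimpleGraph.mulCayley Y).dist (u.seq i).elt (v.seq i).elt / c i) + ε)
      * c i = K * (K * (SimpleGraph.mulCayley Y).dist (u.seq i).elt (v.seq i).elt) + ε * c i := by
    field_simp
  have h4 := mul_le_mul_of_nonneg_left h1 hK'.le
  have h5 := mul_le_mul_of_nonneg_left h3 hK'.le
  rw [mul_add]
  linarith

/-- A sequence at distance at least a fixed multiple of the scale from `1` does not represent the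
base point. -/
lemma ConeSequence.dist_base_pos {s : ConeSequence (WordMetricSpace Y hY) ω c (fun _ => ⟨1⟩)}
    {ε : ℝ} (hε : 0 < ε) (hs : ∀ i, ε * c i ≤ (SimpleGraph.mulCayley Y).dist 1 (s.seq i).elt) :
    0 < dist (ConeSequence.base hY ω c) s :=
  hε.trans_le <| ge_of_tendsto' (ConeSequence.tendsto_dist _ _) fun i =>
    (le_div_iff₀ (c.pos i)).mpr (hs i)

end Cone

/-! ### The cut point -/

theorem theorem1p11 {G : Type*} [Group G]
    (X : Set G) (hXfin : X.Finite) (hX : Subgroup.closure X = ⊤)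
    (H : Subgroup G) (hHinf : Infinite H) (hHindex : Infinite (G ⧸ H))
    (hH : IsStronglyQuasiConvex X hX H)
    (Y : Set G) (hYfin : Y.Finite) (hY : Subgroup.closure Y = ⊤)
    (ω : Ultrafilter ℕ) (hω : ∀ n : ℕ, ω ≠ pure n) (c : ScalingSequence) :
    ∃ p : GroupAsymptoticCone Y hY ω c, IsCutPoint p := by
  refine ⟨SeparationQuotient.mk (ConeSequence.base hY ω c),
    connectedSpace_groupAsymptoticCone hY hω, fun hpre => ?_⟩
  obtain ⟨K₁, -, hXY'⟩ := exists_mulCayley_dist_le_mul hX hYfin hY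
  obtain ⟨K₂, hK₂, hYX'⟩ := exists_mulCayley_dist_le_mul hY hXfin hX
  obtain ⟨K, hK, hXY, hYX⟩ : ∃ K : ℕ, 1 ≤ K ∧
      (∀ g h, (SimpleGraph.mulCayley X).dist g h ≤ K * (SimpleGraph.mulCayley Y).dist g h) ∧
      ∀ g h, (SimpleGraph.mulCayley Y).dist g h ≤ K * (SimpleGraph.mulCayley X).dist g h :=
    ⟨max K₁ K₂, hK₂.trans (le_max_right _ _),
      fun g h => (hXY' g h).trans (Nat.mul_le_mul_right _ (le_max_left _ _)),
      fun g h => (hYX' g h).trans (Nat.mul_le_mul_right _ (le_max_right _ _))⟩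
  have hK' : (1 : ℝ) ≤ K := by exact_mod_cast hK
  -- sequences of `X`-length between `⌈c i⌉` and `⌈c i⌉ + C` represent points `≠` base point
  have point : ∀ (C : ℕ) (g : ℕ → G), (∀ i, ⌈c i⌉₊ ≤ (SimpleGraph.mulCayley X).dist 1 (g i)) →
      (∀ i, (SimpleGraph.mulCayley X).dist 1 (g i) ≤ ⌈c i⌉₊ + C) →
      ∃ s : ConeSequence (WordMetricSpace Y hY) ω c (fun _ => ⟨1⟩), (∀ i, (s.seq i).elt = g i) ∧
        0 < dist (ConeSequence.base hY ω c) s := by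
    intro C g hlow hup
    have hc0 := c.pos 0
    refine ⟨ConeSequence.ofElements hY ω g (K * (1 + (C + 1) / c 0)) fun i => ?_, fun i => rfl,
      ConeSequence.dist_base_pos (ε := (K : ℝ)⁻¹) (by positivity) fun i => ?_⟩
    · have hmono : c 0 ≤ c i := c.strictMono.monotone (Nat.zero_le i)
      have h1 : ((SimpleGraph.mulCayley Y).dist 1 (g i) : ℝ) ≤
          K * (SimpleGraph.mulCayley X).dist 1 (g i) := by exact_mod_cast hYX _ _
      have h2 : ((SimpleGraph.mulCayley X).dist 1 (g i) : ℝ) ≤ ⌈c i⌉₊ + C := by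
        exact_mod_cast hup i
      have h3 := (Nat.ceil_lt_add_one (c.pos i).le).le
      have h4 : (C : ℝ) + 1 ≤ (C + 1) / c 0 * c i := by
        rw [div_mul_eq_mul_div, le_div_iff₀ hc0]
        exact mul_le_mul_of_nonneg_left hmono (by positivity)
      rw [mul_assoc]
      refine h1.trans (mul_le_mul_of_nonneg_left ?_ (by positivity))
      linarith
    · have h1 : ((SimpleGraph.mulCayley X).dist 1 (g i) : ℝ) ≤
          K * (SimpleGraph.mulCayley Y).dist 1 (g i) := by exact_mod_cast hXY _ _
      have h2 : ((⌈c i⌉₊ : ℕ) : ℝ) ≤ (SimpleGraph.mulCayley X).dist 1 (g i) := by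
        exact_mod_cast hlow i
      rw [inv_mul_le_iff₀ (by positivity)]
      exact (Nat.le_ceil _).trans (h2.trans h1)
  -- `x` is a point of the cone that projects to the base point in the limit of `H`
  choose g hg hgdist using fun i => exists_mem_nearestTo_dist_eq hXfin hX H ⌈c i⌉₊
  obtain ⟨x, hx, hx0⟩ := point 0 g (fun i => (hgdist i).ge) fun i => (hgdist i).le
  -- `q` is a second point of the limit of `H`
  obtain ⟨C, hC⟩ := hH.exists_mem_dist hXfin hX
  choose h hhH hlow hup using fun i => hC ⌈c i⌉₊
  obtain ⟨q, hq, hq0⟩ := point C h hlow hup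
  have ne_base : ∀ s : ConeSequence (WordMetricSpace Y hY) ω c (fun _ => ⟨1⟩),
      0 < dist (ConeSequence.base hY ω c) s →
      (SeparationQuotient.mk s : GroupAsymptoticCone Y hY ω c) ≠
        SeparationQuotient.mk (ConeSequence.base hY ω c) := by
    intro s hs he
    rw [← SeparationQuotient.dist_mk, he, dist_self] at hs
    exact lt_irrefl _ hs
  have hxR : ConeReachable X H x := by
    refine ⟨1, le_rfl, 1, one_pos, Eventually.of_forall fun i => ?_⟩
    rw [hx i]
    exact ReachableAvoiding.of_mem_nearestTo (mulCayley_connected hX) (hg i)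
  have hqS := hpre.compl_singleton_subset (K := (K : ℝ) ^ 2)
    (S := SeparationQuotient.mk '' {s | ConeReachable X H s}) ⟨_, ⟨x, hxR, rfl⟩, ne_base x hx0⟩
    (by
      rintro _ ⟨s, hs, rfl⟩ v hv
      obtain ⟨t, rfl⟩ := SeparationQuotient.surjective_mk v
      rw [SeparationQuotient.dist_mk, SeparationQuotient.dist_mk] at hv
      exact ⟨t, ConeReachable.extend hX hK hXY hYX hs hv, rfl⟩)
    (ne_base q hq0)
  obtain ⟨q', hq'R, hq'⟩ := hqS
  have hqR : ConeReachable X H q := by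
    refine ConeReachable.extend hX hK hXY hYX hq'R ?_
    rw [← SeparationQuotient.dist_mk q', hq', dist_self, mul_zero]
    exact hq0
  obtain ⟨L, hL, δ, hδ, hev⟩ := hqR
  obtain ⟨N, hN⟩ := ReachableAvoiding.le_of_isMorse hH H.one_mem hL
  have hδ' : 0 < min δ 1 := lt_min hδ one_pos
  have hbig := ((c.tendsto_atTop hω).const_mul_atTop hδ').eventually_gt_atTop ((N : ℝ) + 1)
  obtain ⟨i, hi, hi'⟩ := (hev.and hbig).exists
  have hpos := c.pos i
  rw [hq i] at hi
  have hci : c i ≤ (SimpleGraph.mulCayley X).dist 1 (h i) :=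
    (Nat.le_ceil _).trans (by exact_mod_cast hlow i)
  -- the multiple of the scale has to be at most `|h i|`, hence the minimum with `1`
  have := hN _ _ (hi.mono (mul_le_mul_of_nonneg_right (min_le_left δ 1) hpos.le)) (hhH i)
    ((mul_le_of_le_one_left hpos.le (min_le_right _ _)).trans hci)
  linarith
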